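/- **Generalization bound for GCN (standard, non-adversarial setting).** There is a universal constant $C>0$ such that the following holds. Let $l\ge 2$, let $h_0,\dots,h_l$ be layer widths with $h_k\le h$ for all $0\le k\le l$, and let $K=h_l\ge 2$ be the number of classes. A sample is a pair $(G,y)$ of a graph $G=(X,A)$ and a label $y\in\{1,\dots,K\}$, where $X\in\mathbb R^{n\times h_0}$ is the node feature matrix and $A\in\{0,1\}^{n\times n}$ is the adjacency matrix of an undirected simple graph with $n\ge 1$ nodes ($n$ may depend on $G$). For parameters $w=(W_1,\dots,W_l)$ with $W_k\in\mathbb R^{h_{k-1}\times h_k}$, the GCN is $$H_0=X,\qquad H_k=\max\bigl(0,\;P_G H_{k-1}W_k\bigr)\ (1\le k\le l-1)\ \text{entrywise},\qquad f_w(G)=\tfrac1n\mathbf 1_n H_{l-1}W_l\in\mathbb R^{1\times K},$$ where $\mathbf 1_n$ is the all-ones row vector, $P_G=\tilde D^{-1/2}\tilde A\tilde D^{-1/2}$, $\tilde A=A+I$ and $\tilde D=\mathrm{diag}\bigl(\sum_j\tilde A_{ij}\bigr)_i$. Let $M(f_w(G),y)=f_w(G)_y-\max_{j\ne y}f_w(G)_j$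 be the margin. Let $\mathcal D$ be a probability distribution on samples under which $\|X\|_2\le B$ almost surely, and put $$L_0(f_w)=\mathbb P_{(G,y)\sim\mathcal D}\{M(f_w(G),y)\le 0\},\qquad \hat L_\gamma(f_w)=\frac1m\sum_{(G,y)\in S}\mathbf 1\{M(f_w(G),y)\le\gamma\}.$$ Then for all $\delta,\gamma>0$ and $m\ge1$, with probability at least $1-\delta$ over a training set $S$ of $m$ independent samples from $\mathcal D$, for all $w$ simultaneously, $$L_0(f_w)\le\hat L_\gamma(f_w)+C\sqrt{\frac{B^2l^2h\log(lh)\,\Phi(f_w)+\max(1,\gamma^2)\log(ml/\delta)}{\gamma^2m}},$$ where $$\Phi(f_w)=\prod_{i=1}^l\|W_i\|_2^2\ \sum_{i=1}^l\frac{\|W_i\|_F^2}{\|W_i\|_2^2}$$ (and $\Phi(f_w)=0$ if some $W_i=0$), with $\|\cdot\|_2$ the spectral norm and $\|\cdot\|_F$ the Frobenius norm. In particular, for $\gamma\le1$ the added term is $$O\!\left(\sqrt{\frac{B^2l^2h\log(lh)\Phi(f_w)+\log(ml/\delta)}{\gamma^2m}}\right).$$ The bound does not depend on the maximum degree of the graphs.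 -/

import Mathlib

open MeasureTheory
open scoped Matrix

namespace GCN

noncomputable section

open scoped Matrix.Norms.L2Operator in
/-- The spectral norm of a real matrix (operator norm for the Euclidean norms). -/
def specNorm {p q : ℕ} (M : Matrix (Fin p) (Fin q) ℝ) : ℝ := ‖M‖

open scoped Matrix.Norms.Frobenius in
/-- The Frobenius norm of a real matrix. -/
def frobNorm {p q : ℕ} (M : Matrix (Fin p) (Fin q) ℝ) : ℝ := ‖M‖

/-- Graph data with input feature dimension `h₀`: a number `n ≥ 1` of nodes, a feature matrix
`X ∈ ℝ^{n × h₀}` and a matrix `A ∈ ℝ^{n × n}` (required to be an adjacency matrix in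
`Admissible`).  The number of nodes may vary from graph to graph; the type carries the measurable
structure of the countable disjoint union of the Borel spaces `ℝ^{n × h₀} × ℝ^{n × n}`. -/
abbrev GraphData (h₀ : ℕ) : Type :=
  Σ n : ℕ+, (Fin n → Fin h₀ → ℝ) × (Fin n → Fin n → ℝ)

/-- The feature matrix of a graph. -/
def GraphData.X {h₀ : ℕ} (G : GraphData h₀) : Matrix (Fin G.1) (Fin h₀) ℝ :=
  Matrix.of G.2.1

/-- The adjacency matrix of a graph. -/
def GraphData.A {h₀ : ℕ} (G : GraphData h₀) : Matrix (Fin G.1) (Fin G.1) ℝ :=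
  Matrix.of G.2.2

/-- `A` is the adjacency matrix of an undirected graph, and the feature matrix has spectral norm
at most `B`. -/
def Admissible {h₀ : ℕ} (B : ℝ) (G : GraphData h₀) : Prop :=
  G.A.IsAdjMatrix ∧ specNorm G.X ≤ B

/-- The diffusion matrix `D̃^{-1/2} Ã D̃^{-1/2}` with `Ã = A + I` and
`D̃ = diag (∑ⱼ Ãᵢⱼ)`. -/
def laplacian {n : ℕ} (A : Matrix (Fin n) (Fin n) ℝ) : Matrix (Fin n) (Fin n) ℝ :=
  Matrix.diagonal (fun i => (√(∑ j, (A + 1) i j))⁻¹) * (A + 1) *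
    Matrix.diagonal (fun i => (√(∑ j, (A + 1) i j))⁻¹)

/-- The parameters of a GCN with `L` hidden layers, hence `l = L + 1` layers, and layer widths
`h₀ = d 0, …, h_l = d (L + 1)`: matrices `W k ∈ ℝ^{d k × d (k+1)}` for `k = 0, …, L`
(numbered from `0`). -/
abbrev Weights (L : ℕ) (d : ℕ → ℕ) : Type :=
  (k : Fin (L + 1)) → Matrix (Fin (d k)) (Fin (d (k + 1))) ℝ

/-- The node representations: `H₀ = X` and `H_k = ReLU (P_G H_{k-1} W_k)`. -/
def nodeRep {L : ℕ} {d : ℕ → ℕ} (W : Weights L d) (G : GraphData (d 0)) :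
    (k : ℕ) → k ≤ L → Matrix (Fin G.1) (Fin (d k)) ℝ
  | 0, _ => G.X
  | k + 1, hk =>
      (laplacian G.A * nodeRep W G k (Nat.le_of_succ_le hk) *
        W ⟨k, Nat.lt_succ_of_le (Nat.le_of_succ_le hk)⟩).map (fun x => max 0 x)

/-- The GCN output `f_w(G) = (1/n) 1ₙ H_{l-1} W_l`, a vector indexed by the
`K = d (L + 1)` classes. -/
def output {L : ℕ} {d : ℕ → ℕ} (W : Weights L d) (G : GraphData (d 0)) : Fin (d (L + 1)) → ℝ :=
  (fun _ : Fin G.1 => 1 / (G.1 : ℝ)) ᵥ* (nodeRep W G L le_rfl * W ⟨L, L.lt_succ_self⟩)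

/-- The margin operator `f_w(G)_y - max_{j ≠ y} f_w(G)_j` at a labelled graph `z = (G, y)`. -/
def margin {L : ℕ} {d : ℕ → ℕ} (W : Weights L d) (z : GraphData (d 0) × Fin (d (L + 1))) : ℝ :=
  output W z.1 z.2 - ⨆ j : {j : Fin (d (L + 1)) // j ≠ z.2}, output W z.1 j

/-- The expected margin loss `ℙ_{z ∼ D} (margin ≤ γ)`. -/
def expectedLoss {L : ℕ} {d : ℕ → ℕ} (D : Measure (GraphData (d 0) × Fin (d (L + 1))))
    (γ : ℝ) (W : Weights L d) : ℝ :=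
  D.real {z | margin W z ≤ γ}

/-- The empirical margin loss over a training set `S` of size `m`. -/
def empiricalLoss {L m : ℕ} {d : ℕ → ℕ} (S : Fin m → GraphData (d 0) × Fin (d (L + 1)))
    (γ : ℝ) (W : Weights L d) : ℝ :=
  (1 / (m : ℝ)) * ∑ i, {z | margin W z ≤ γ}.indicator (fun _ => (1 : ℝ)) (S i)

/-- The complexity `Φ(f_w) = ∏ᵢ ‖Wᵢ‖₂² ∑ᵢ ‖Wᵢ‖_F² / ‖Wᵢ‖₂²`; it is `0` if some `Wᵢ = 0`. -/
def complexity {L : ℕ} {d : ℕ → ℕ} (W : Weights L d) : ℝ :=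
  (∏ k, specNorm (W k) ^ 2) * ∑ k, frobNorm (W k) ^ 2 / specNorm (W k) ^ 2

end

end GCN

/-! The proof compresses each network to a short discrete code and takes a union bound over codes.
Positive homogeneity of ReLU gives f_w = s f_v, where s = ∏ ‖W_k‖₂ and v has its layers divided by
their spectral norms (`output_eq_prod_mul`). On admissible graphs the outputs of f_v are at most B
in absolute value, and moving each layer by ε in spectral norm moves them by at most ((1+ε)^l - 1) B
(`abs_output_sub_le`). Degrees and n drop out: P_G contracts the Frobenius norm, and the 1/√n gained
by averaging cancels the √n in ‖X‖_F ≤ √n ‖X‖₂.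

So v is needed only up to about 1/(la) in spectral norm, with a ≈ 8sB/γ. Let F = ∑ ‖v_k‖_F². While
some rank-one atom correlates with the residual by more than τ, subtracting τ times it lowers the
squared Frobenius norm by at least τ²; hence F/τ² atoms serve all layers at once
(`exists_atom_approx`). Grid atoms number exp(O(h log(lh))), so a code costs O(l²a²F · h log(lh)),
which is O(B²l²h log(lh) Φ/γ²).

The events "rescaled coded margin ≤ γ/2" do not depend on w, and `measure_exists_freq_add_lt_le`
controls them all simultaneously. Since `exists_code` distorts margins by at most γ/2, they sandwich
between the true loss at 0 and the empirical loss at γ. If sB ≤ γ/2 no code is needed: all margins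
are at most γ and the empirical loss is 1. -/

namespace GCN

/-! ### Frobenius and spectral norms; contraction by the diffusion matrix and ReLU. -/

open scoped Matrix.Norms.Frobenius in
lemma frobNorm_nonneg {p q : ℕ} (M : Matrix (Fin p) (Fin q) ℝ) : 0 ≤ frobNorm M := by
  unfold frobNorm; exact norm_nonneg _

open scoped Matrix.Norms.Frobenius in
lemma frobNorm_add_le {p q : ℕ} (M N : Matrix (Fin p) (Fin q) ℝ) :
    frobNorm (M + N) ≤ frobNorm M + frobNorm N := by
  unfold frobNorm; exact norm_add_le _ _

open scoped Matrix.Norms.Frobenius in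
lemma frobNorm_sq {p q : ℕ} (M : Matrix (Fin p) (Fin q) ℝ) :
    frobNorm M ^ 2 = ∑ i, ∑ j, M i j ^ 2 := by
  unfold frobNorm
  rw [Matrix.frobenius_norm_def, ← Real.sqrt_eq_rpow, Real.sq_sqrt (by positivity)]
  simp

open scoped Matrix.Norms.Frobenius in
lemma frobNorm_smul {p q : ℕ} (c : ℝ) (M : Matrix (Fin p) (Fin q) ℝ) :
    frobNorm (c • M) = |c| * frobNorm M := by
  unfold frobNorm; rw [norm_smul, Real.norm_eq_abs]

lemma frobNorm_le_of_sq_le {p q : ℕ} {M : Matrix (Fin p) (Fin q) ℝ} {c : ℝ} (hc : 0 ≤ c)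
    (h : ∑ i, ∑ j, M i j ^ 2 ≤ c ^ 2) : frobNorm M ≤ c :=
  abs_le_of_sq_le_sq' (by rwa [frobNorm_sq]) hc |>.2

open scoped Matrix.Norms.L2Operator in
lemma specNorm_nonneg {p q : ℕ} (M : Matrix (Fin p) (Fin q) ℝ) : 0 ≤ specNorm M := by
  unfold specNorm; exact norm_nonneg _

open scoped Matrix.Norms.L2Operator in
lemma specNorm_smul {p q : ℕ} (c : ℝ) (M : Matrix (Fin p) (Fin q) ℝ) :
    specNorm (c • M) = |c| * specNorm M := by
  unfold specNorm; rw [norm_smul, Real.norm_eq_abs]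

open scoped Matrix.Norms.L2Operator in
lemma specNorm_add_le {p q : ℕ} (M N : Matrix (Fin p) (Fin q) ℝ) :
    specNorm (M + N) ≤ specNorm M + specNorm N := by
  unfold specNorm; exact norm_add_le _ _

open scoped Matrix.Norms.L2Operator in
lemma specNorm_eq_zero {p q : ℕ} {M : Matrix (Fin p) (Fin q) ℝ} : specNorm M = 0 ↔ M = 0 := by
  unfold specNorm; exact norm_eq_zero

open scoped Matrix.Norms.L2Operator in
lemma specNorm_transpose {p q : ℕ} (M : Matrix (Fin p) (Fin q) ℝ) :
    specNorm Mᵀ = specNorm M := by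
  unfold specNorm
  rw [← Matrix.conjTranspose_eq_transpose_of_trivial, Matrix.l2_opNorm_conjTranspose]

open scoped Matrix.Norms.L2Operator in
lemma sum_mulVec_sq_le {p q : ℕ} (M : Matrix (Fin p) (Fin q) ℝ) (v : Fin q → ℝ) :
    ∑ i, (M *ᵥ v) i ^ 2 ≤ specNorm M ^ 2 * ∑ j, v j ^ 2 := by
  have h := Matrix.l2_opNorm_mulVec M (WithLp.toLp 2 v)
  have h2 := pow_le_pow_left₀ (norm_nonneg _) h 2
  rw [mul_pow, EuclideanSpace.norm_sq_eq, EuclideanSpace.norm_sq_eq] at h2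
  simpa [specNorm] using h2

lemma sum_vecMul_sq_le {p q : ℕ} (M : Matrix (Fin p) (Fin q) ℝ) (v : Fin p → ℝ) :
    ∑ j, (v ᵥ* M) j ^ 2 ≤ specNorm M ^ 2 * ∑ i, v i ^ 2 := by
  have h := sum_mulVec_sq_le Mᵀ v
  rwa [specNorm_transpose, Matrix.mulVec_transpose] at h

open scoped Matrix.Norms.L2Operator in
lemma specNorm_le_of_mulVec {p q : ℕ} {M : Matrix (Fin p) (Fin q) ℝ} {c : ℝ} (hc : 0 ≤ c)
    (h : ∀ v : Fin q → ℝ, ∑ i, (M *ᵥ v) i ^ 2 ≤ c ^ 2 * ∑ j, v j ^ 2) : specNorm M ≤ c := by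
  unfold specNorm
  rw [Matrix.l2_opNorm_def]
  refine ContinuousLinearMap.opNorm_le_bound _ hc fun x => ?_
  refine abs_le_of_sq_le_sq' ?_ (by positivity) |>.2
  rw [mul_pow, EuclideanSpace.norm_sq_eq, EuclideanSpace.norm_sq_eq]
  simpa using h x.ofLp

/-- Cauchy–Schwarz for finite sums over `Fin`, in the form used for bilinear forms. -/
lemma dotProduct_le_of_sq_le {p : ℕ} {x y : Fin p → ℝ} {a b : ℝ} (ha : 0 ≤ a) (hb : 0 ≤ b)
    (hx : ∑ i, x i ^ 2 ≤ a ^ 2) (hy : ∑ i, y i ^ 2 ≤ b ^ 2) : x ⬝ᵥ y ≤ a * b := by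
  have h := Finset.sum_mul_sq_le_sq_mul_sq Finset.univ x y
  refine abs_le_of_sq_le_sq' ?_ (by positivity) |>.2
  unfold dotProduct
  rw [mul_pow]
  exact h.trans (mul_le_mul hx hy (by positivity) (by positivity))

/-- A one-sided bound suffices because x may be taken parallel to M y. -/
lemma specNorm_le_of_bilin {p q : ℕ} {M : Matrix (Fin p) (Fin q) ℝ} {c : ℝ} (hc : 0 ≤ c)
    (h : ∀ (x : Fin p → ℝ) (y : Fin q → ℝ), ∑ i, x i ^ 2 ≤ 1 → ∑ j, y j ^ 2 ≤ 1 →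
      x ⬝ᵥ (M *ᵥ y) ≤ c) : specNorm M ≤ c := by
  refine specNorm_le_of_mulVec hc fun v => ?_
  set a := √(∑ i, (M *ᵥ v) i ^ 2) with ha
  set b := √(∑ j, v j ^ 2) with hb
  have ha2 : a ^ 2 = ∑ i, (M *ᵥ v) i ^ 2 := Real.sq_sqrt (by positivity)
  have hb2 : b ^ 2 = ∑ j, v j ^ 2 := Real.sq_sqrt (by positivity)
  have ha0 : 0 ≤ a := Real.sqrt_nonneg _
  have hb0 : 0 ≤ b := Real.sqrt_nonneg _
  rw [← ha2, ← hb2, ← mul_pow]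
  refine pow_le_pow_left₀ ha0 ?_ 2
  rcases ha0.eq_or_lt with ha' | ha'
  · rw [← ha']; positivity
  rcases hb0.eq_or_lt with hb' | hb'
  · exfalso
    have h1 := sum_mulVec_sq_le M v
    rw [← ha2, ← hb2, ← hb'] at h1
    nlinarith
  have := h (a⁻¹ • (M *ᵥ v)) (b⁻¹ • v) ?_ ?_
  · have h3 : (M *ᵥ v) ⬝ᵥ (M *ᵥ v) = a ^ 2 := by
      rw [ha2]; simp [dotProduct, sq]
    rw [Matrix.mulVec_smul, smul_dotProduct, dotProduct_smul, h3] at this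
    simp only [smul_eq_mul] at this
    field_simp at this
    linarith
  · simp only [Pi.smul_apply, smul_eq_mul, mul_pow, ← Finset.mul_sum, ← ha2]
    field_simp; rfl
  · simp only [Pi.smul_apply, smul_eq_mul, mul_pow, ← Finset.mul_sum, ← hb2]
    field_simp; rfl

lemma frobNorm_mul_le {n p q : ℕ} (H : Matrix (Fin n) (Fin p) ℝ) (W : Matrix (Fin p) (Fin q) ℝ) :
    frobNorm (H * W) ≤ frobNorm H * specNorm W := by
  refine frobNorm_le_of_sq_le (mul_nonneg (frobNorm_nonneg _) (specNorm_nonneg _)) ?_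
  rw [mul_pow, frobNorm_sq, mul_comm, Finset.mul_sum]
  exact Finset.sum_le_sum fun i _ => sum_vecMul_sq_le W (H i)

lemma frobNorm_le_sqrt_mul_specNorm {n p : ℕ} (X : Matrix (Fin n) (Fin p) ℝ) :
    frobNorm X ≤ √n * specNorm X := by
  refine frobNorm_le_of_sq_le (mul_nonneg (Real.sqrt_nonneg _) (specNorm_nonneg _)) ?_
  rw [mul_pow, Real.sq_sqrt (Nat.cast_nonneg _)]
  calc ∑ i, ∑ j, X i j ^ 2 ≤ ∑ _i : Fin n, specNorm X ^ 2 := by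
        refine Finset.sum_le_sum fun i _ => ?_
        have h := sum_vecMul_sq_le X (Pi.single i 1)
        rw [Matrix.single_one_vecMul] at h
        have h1 : ∑ j : Fin n, (Pi.single i (1 : ℝ) : Fin n → ℝ) j ^ 2 = 1 := by
          simp [Pi.single_apply]
        rw [h1, mul_one] at h
        exact h
    _ = n * specNorm X ^ 2 := by simp

lemma specNorm_le_frobNorm {p q : ℕ} (M : Matrix (Fin p) (Fin q) ℝ) :
    specNorm M ≤ frobNorm M := by
  refine specNorm_le_of_mulVec (frobNorm_nonneg _) fun v => ?_
  rw [frobNorm_sq, Finset.sum_mul]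
  exact Finset.sum_le_sum fun i _ => Finset.sum_mul_sq_le_sq_mul_sq Finset.univ (M i) v

/-- A Schur test for the symmetric nonnegative matrix Ã: Cauchy–Schwarz along each row, then
summation over columns, where the degree weights cancel. This is why the maximum degree never
enters. -/
lemma frobNorm_laplacian_mul_le {n p : ℕ} {A : Matrix (Fin n) (Fin n) ℝ} (hA : A.IsAdjMatrix)
    (H : Matrix (Fin n) (Fin p) ℝ) : frobNorm (laplacian A * H) ≤ frobNorm H := by
  refine frobNorm_le_of_sq_le (frobNorm_nonneg _) ?_
  rw [frobNorm_sq]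
  set T : Matrix (Fin n) (Fin n) ℝ := A + 1 with hT
  have hT0 : ∀ i j, 0 ≤ T i j := by
    intro i j
    have h1 : 0 ≤ A i j := by rcases hA.zero_or_one i j with h | h <;> simp [h]
    have h2 : (0 : ℝ) ≤ (1 : Matrix (Fin n) (Fin n) ℝ) i j := by
      rw [Matrix.one_apply]; split_ifs <;> norm_num
    exact add_nonneg h1 h2
  have hsymm : ∀ i j, T i j = T j i := by
    intro i j
    have h1 : A i j = A j i := hA.symm.apply j i
    have h2 : (1 : Matrix (Fin n) (Fin n) ℝ) i j = (1 : Matrix (Fin n) (Fin n) ℝ) j i := by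
      simp [Matrix.one_apply, eq_comm]
    simp [hT, h1, h2]
  set e : Fin n → ℝ := fun i => ∑ j, T i j with he
  have he0 : ∀ i, 0 < e i := by
    intro i
    refine lt_of_lt_of_le ?_ (Finset.single_le_sum (fun j _ => hT0 i j) (Finset.mem_univ i))
    simp [hT, hA.apply_diag i]
  -- Splitting T into √T · √T places the row normalization in the first factor, whose squares then
  -- sum to 1.
  have hent : ∀ i c, (laplacian A * H) i c
      = ∑ j, (√(T i j) * (√(e i))⁻¹) * (√(T i j) * ((√(e j))⁻¹ * H j c)) := by
    intro i c
    rw [Matrix.mul_apply]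
    refine Finset.sum_congr rfl fun j _ => ?_
    have : laplacian A i j = (√(e i))⁻¹ * T i j * (√(e j))⁻¹ := by
      unfold laplacian
      rw [Matrix.mul_diagonal, Matrix.diagonal_mul]
    rw [this]
    have h3 : √(T i j) * √(T i j) = T i j := Real.mul_self_sqrt (hT0 i j)
    calc _ = (√(e i))⁻¹ * (√(T i j) * √(T i j)) * (√(e j))⁻¹ * H j c := by rw [h3]
      _ = _ := by ring
  have key : ∀ i c, (laplacian A * H) i c ^ 2 ≤ ∑ j, T i j * ((e j)⁻¹ * H j c ^ 2) := by
    intro i c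
    rw [hent]
    refine (Finset.sum_mul_sq_le_sq_mul_sq _ _ _).trans (le_of_eq ?_)
    have h1 : ∑ j, (√(T i j) * (√(e i))⁻¹) ^ 2 = 1 := by
      simp_rw [mul_pow, inv_pow, Real.sq_sqrt (hT0 i _), Real.sq_sqrt (he0 i).le]
      rw [← Finset.sum_mul]
      exact mul_inv_cancel₀ (he0 i).ne'
    rw [h1, one_mul]
    refine Finset.sum_congr rfl fun j _ => ?_
    rw [mul_pow, mul_pow, inv_pow, Real.sq_sqrt (hT0 i j), Real.sq_sqrt (he0 j).le]
  calc ∑ i, ∑ c, (laplacian A * H) i c ^ 2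
      ≤ ∑ i, ∑ c, ∑ j, T i j * ((e j)⁻¹ * H j c ^ 2) :=
        Finset.sum_le_sum fun i _ => Finset.sum_le_sum fun c _ => key i c
    _ = ∑ j, ∑ c, ∑ i, T i j * ((e j)⁻¹ * H j c ^ 2) := by
        simp_rw [Finset.sum_comm (s := (Finset.univ : Finset (Fin p)))]
        rw [Finset.sum_comm]
    _ = ∑ j, ∑ c, H j c ^ 2 := by
        refine Finset.sum_congr rfl fun j _ => Finset.sum_congr rfl fun c _ => ?_
        rw [← Finset.sum_mul]
        simp_rw [hsymm _ j]
        rw [← mul_assoc, show ∑ x, T j x = e j from rfl, mul_inv_cancel₀ (he0 j).ne', one_mul]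

lemma frobNorm_relu_sub_le {n p : ℕ} (M N : Matrix (Fin n) (Fin p) ℝ) :
    frobNorm (M.map (fun x => max 0 x) - N.map (fun x => max 0 x)) ≤ frobNorm (M - N) := by
  refine frobNorm_le_of_sq_le (frobNorm_nonneg _) ?_
  rw [frobNorm_sq]
  refine Finset.sum_le_sum fun i _ => Finset.sum_le_sum fun j _ => sq_le_sq.2 ?_
  simp only [Matrix.sub_apply, Matrix.map_apply]
  simpa using abs_max_sub_max_le_max (0 : ℝ) (M i j) 0 (N i j)

lemma frobNorm_relu_le {n p : ℕ} (M : Matrix (Fin n) (Fin p) ℝ) :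
    frobNorm (M.map (fun x => max 0 x)) ≤ frobNorm M := by
  have h := frobNorm_relu_sub_le M 0
  have h0 : (0 : Matrix (Fin n) (Fin p) ℝ).map (fun x => max 0 x) = 0 := by ext; simp
  rwa [h0, sub_zero, sub_zero] at h

/-! ### Size, stability and homogeneity of the network. -/

section Network

variable {L : ℕ} {d : ℕ → ℕ}

lemma frobNorm_nodeRep_le {W : Weights L d} {c : ℝ} (hc : 0 ≤ c) (hW : ∀ k, specNorm (W k) ≤ c)
    {G : GraphData (d 0)} (hG : G.A.IsAdjMatrix) :
    ∀ (k : ℕ) (hk : k ≤ L), frobNorm (nodeRep W G k hk) ≤ c ^ k * frobNorm G.X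
  | 0, _ => by simp [nodeRep]
  | k + 1, hk => by
    have ih := frobNorm_nodeRep_le hc hW hG k (Nat.le_of_succ_le hk)
    rw [nodeRep]
    refine (frobNorm_relu_le _).trans ?_
    refine (frobNorm_mul_le _ _).trans ?_
    calc _ ≤ (c ^ k * frobNorm G.X) * c :=
          mul_le_mul ((frobNorm_laplacian_mul_le hG _).trans ih) (hW _) (specNorm_nonneg _)
            (mul_nonneg (by positivity) (frobNorm_nonneg _))
      _ = _ := by ring

/-- The errors satisfy e_{k+1} ≤ (1+ε) e_k + ε ‖X‖_F with e_0 = 0, and the bound is the solution of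
this recursion. -/
lemma frobNorm_nodeRep_sub_le {W W' : Weights L d} {ε : ℝ} (hε : 0 ≤ ε)
    (hW : ∀ k, specNorm (W k) ≤ 1) (hWW : ∀ k, specNorm (W k - W' k) ≤ ε)
    (hW' : ∀ k, specNorm (W' k) ≤ 1 + ε)
    {G : GraphData (d 0)} (hG : G.A.IsAdjMatrix) :
    ∀ (k : ℕ) (hk : k ≤ L), frobNorm (nodeRep W G k hk - nodeRep W' G k hk)
      ≤ ((1 + ε) ^ k - 1) * frobNorm G.X
  | 0, _ => by
    rw [nodeRep, nodeRep, sub_self, pow_zero, sub_self, zero_mul]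
    exact frobNorm_le_of_sq_le le_rfl (by simp)
  | k + 1, hk => by
    have ih := frobNorm_nodeRep_sub_le hε hW hWW hW' hG k (Nat.le_of_succ_le hk)
    have h1 := frobNorm_nodeRep_le zero_le_one hW hG k (Nat.le_of_succ_le hk)
    rw [one_pow, one_mul] at h1
    rw [nodeRep, nodeRep]
    refine (frobNorm_relu_sub_le _ _).trans ?_
    set H := nodeRep W G k (Nat.le_of_succ_le hk)
    set H' := nodeRep W' G k (Nat.le_of_succ_le hk)
    set P := laplacian G.A
    set i : Fin (L + 1) := ⟨k, Nat.lt_succ_of_le (Nat.le_of_succ_le hk)⟩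
    have hsplit : P * H * W i - P * H' * W' i
        = P * H * (W i - W' i) + P * (H - H') * W' i := by
      rw [Matrix.mul_sub, Matrix.mul_sub, Matrix.sub_mul]; abel
    have e1 : frobNorm (P * H * (W i - W' i)) ≤ frobNorm G.X * ε :=
      (frobNorm_mul_le _ _).trans (mul_le_mul ((frobNorm_laplacian_mul_le hG _).trans h1)
        (hWW i) (specNorm_nonneg _) (frobNorm_nonneg _))
    have e2 : frobNorm (P * (H - H') * W' i) ≤ ((1 + ε) ^ k - 1) * frobNorm G.X * (1 + ε) :=
      (frobNorm_mul_le _ _).trans (mul_le_mul ((frobNorm_laplacian_mul_le hG _).trans ih)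
        (hW' i) (specNorm_nonneg _) ((frobNorm_nonneg _).trans ih))
    calc _ = frobNorm (P * H * (W i - W' i) + P * (H - H') * W' i) := by rw [← hsplit]
      _ ≤ frobNorm G.X * ε + ((1 + ε) ^ k - 1) * frobNorm G.X * (1 + ε) :=
          (frobNorm_add_le _ _).trans (add_le_add e1 e2)
      _ = _ := by ring

/-- Cauchy–Schwarz against the averaging vector, whose Euclidean norm is 1/√n. -/
lemma abs_mean_vecMul_le {n : ℕ+} {p : ℕ} (M : Matrix (Fin n) (Fin p) ℝ) (j : Fin p) :
    |((fun _ : Fin n => 1 / (n : ℝ)) ᵥ* M) j| ≤ frobNorm M / √n := by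
  have hn : (0 : ℝ) < n := by exact_mod_cast n.pos
  refine abs_le_of_sq_le_sq ?_ (div_nonneg (frobNorm_nonneg _) (Real.sqrt_nonneg _))
  rw [div_pow, Real.sq_sqrt hn.le, frobNorm_sq]
  have h := Finset.sum_mul_sq_le_sq_mul_sq Finset.univ (fun _ : Fin n => 1 / (n : ℝ))
    (fun i => M i j)
  refine le_trans h ?_
  have h1 : ∑ _i : Fin n, (1 / (n : ℝ)) ^ 2 = 1 / (n : ℝ) := by
    simp; field_simp
  rw [h1, div_mul_eq_mul_div, one_mul]
  gcongr with i
  exact Finset.single_le_sum (f := fun j => M i j ^ 2) (fun _ _ => sq_nonneg _) (Finset.mem_univ j)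

lemma frobNorm_X_div_sqrt_le {B : ℝ} {G : GraphData (d 0)} (hG : Admissible B G) :
    frobNorm G.X / √(G.1 : ℕ) ≤ B := by
  have hn : (0 : ℝ) < (G.1 : ℕ) := by exact_mod_cast G.1.pos
  rw [div_le_iff₀ (Real.sqrt_pos.2 hn), mul_comm]
  exact (frobNorm_le_sqrt_mul_specNorm _).trans
    (mul_le_mul_of_nonneg_left hG.2 (Real.sqrt_nonneg _))

lemma abs_output_le {W : Weights L d} (hW : ∀ k, specNorm (W k) ≤ 1) {B : ℝ} {G : GraphData (d 0)}
    (hG : Admissible B G) (j : Fin (d (L + 1))) : |output W G j| ≤ B := by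
  refine (abs_mean_vecMul_le _ j).trans (le_trans ?_ (frobNorm_X_div_sqrt_le hG))
  gcongr
  refine (frobNorm_mul_le _ _).trans ?_
  have h1 := frobNorm_nodeRep_le zero_le_one hW hG.1 L le_rfl
  rw [one_pow, one_mul] at h1
  calc _ ≤ frobNorm G.X * 1 := mul_le_mul h1 (hW _) (specNorm_nonneg _) (frobNorm_nonneg _)
    _ = _ := mul_one _

lemma abs_output_sub_le {W W' : Weights L d} {ε : ℝ} (hε : 0 ≤ ε)
    (hW : ∀ k, specNorm (W k) ≤ 1) (hWW : ∀ k, specNorm (W k - W' k) ≤ ε)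
    {B : ℝ} {G : GraphData (d 0)} (hG : Admissible B G) (j : Fin (d (L + 1))) :
    |output W G j - output W' G j| ≤ ((1 + ε) ^ (L + 1) - 1) * B := by
  have hW' : ∀ k, specNorm (W' k) ≤ 1 + ε := by
    intro k
    have h1 := specNorm_add_le (W k) ((-1 : ℝ) • (W k - W' k))
    rw [specNorm_smul] at h1
    have h2 : W k + (-1 : ℝ) • (W k - W' k) = W' k := by simp
    rw [h2] at h1
    have := hW k; have := hWW k
    norm_num at h1
    linarith
  have hr : 0 ≤ (1 + ε) ^ (L + 1) - 1 := sub_nonneg.2 (one_le_pow₀ (by linarith))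
  have e : output W G j - output W' G j = ((fun _ : Fin G.1 => 1 / (G.1 : ℝ)) ᵥ*
      (nodeRep W G L le_rfl * W ⟨L, L.lt_succ_self⟩
        - nodeRep W' G L le_rfl * W' ⟨L, L.lt_succ_self⟩)) j := by
    rw [Matrix.vecMul_sub]; rfl
  rw [e]
  refine (abs_mean_vecMul_le _ j).trans
    (le_trans ?_ (mul_le_mul_of_nonneg_left (frobNorm_X_div_sqrt_le hG) hr))
  rw [← mul_div_assoc]
  gcongr
  have h1 := frobNorm_nodeRep_le zero_le_one hW hG.1 L le_rfl
  rw [one_pow, one_mul] at h1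
  have ih := frobNorm_nodeRep_sub_le hε hW hWW hW' hG.1 L le_rfl
  set H := nodeRep W G L le_rfl
  set H' := nodeRep W' G L le_rfl
  set i : Fin (L + 1) := ⟨L, L.lt_succ_self⟩
  have hsplit : H * W i - H' * W' i = H * (W i - W' i) + (H - H') * W' i := by
    rw [Matrix.mul_sub, Matrix.sub_mul]; abel
  have e1 : frobNorm (H * (W i - W' i)) ≤ frobNorm G.X * ε :=
    (frobNorm_mul_le _ _).trans (mul_le_mul h1 (hWW i) (specNorm_nonneg _) (frobNorm_nonneg _))
  have e2 : frobNorm ((H - H') * W' i) ≤ ((1 + ε) ^ L - 1) * frobNorm G.X * (1 + ε) :=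
    (frobNorm_mul_le _ _).trans (mul_le_mul ih
      (hW' i) (specNorm_nonneg _) ((frobNorm_nonneg _).trans ih))
  calc _ = frobNorm (H * (W i - W' i) + (H - H') * W' i) := by rw [← hsplit]
    _ ≤ frobNorm G.X * ε + ((1 + ε) ^ L - 1) * frobNorm G.X * (1 + ε) :=
        (frobNorm_add_le _ _).trans (add_le_add e1 e2)
    _ = _ := by ring

lemma relu_smul {n p : ℕ} {c : ℝ} (hc : 0 ≤ c) (M : Matrix (Fin n) (Fin p) ℝ) :
    (c • M).map (fun x => max 0 x) = c • M.map (fun x => max 0 x) := by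
  ext i j
  simp [mul_max_of_nonneg _ _ hc]

lemma nodeRep_smul (W : Weights L d) {c : Fin (L + 1) → ℝ} (hc : ∀ k, 0 ≤ c k)
    (G : GraphData (d 0)) :
    ∀ (k : ℕ) (hk : k ≤ L), nodeRep (fun i => c i • W i) G k hk
      = (∏ i : Fin k, c ⟨i, i.2.trans_le (hk.trans L.le_succ)⟩) • nodeRep W G k hk
  | 0, _ => by simp [nodeRep]
  | k + 1, hk => by
    rw [nodeRep, nodeRep, nodeRep_smul W hc G k (Nat.le_of_succ_le hk), Fin.prod_univ_castSucc,
      ← relu_smul (mul_nonneg (Finset.prod_nonneg fun _ _ => hc _) (hc _))]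
    congr 1
    rw [Matrix.mul_smul, Matrix.mul_smul, Matrix.smul_mul, smul_smul, mul_comm]
    rfl

lemma output_smul (W : Weights L d) {c : Fin (L + 1) → ℝ} (hc : ∀ k, 0 ≤ c k)
    (G : GraphData (d 0)) (j : Fin (d (L + 1))) :
    output (fun i => c i • W i) G j = (∏ i, c i) * output W G j := by
  unfold output
  rw [nodeRep_smul W hc G, Fin.prod_univ_castSucc, Matrix.mul_smul, Matrix.smul_mul, smul_smul,
    Matrix.vecMul_smul, Pi.smul_apply, smul_eq_mul, mul_comm (c _)]
  rfl

end Network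

/-! ### Sparse approximation by rank-one grid atoms. -/

/-- Matching pursuit: subtracting greedily `τ` times atoms of norm at most `1` that correlate with
the residual by more than `τ`, one is finished after at most `‖x‖² / τ²` steps. -/
lemma exists_sum_atoms {ι α : Type*} [Fintype ι] (atom : α → ι → ℝ) {τ : ℝ} (hτ : 0 < τ) :
    ∀ (N : ℕ) (x : ι → ℝ), x ⬝ᵥ x ≤ N * τ ^ 2 → ∃ (r : ℕ) (g : Fin r → α),
      r * τ ^ 2 ≤ x ⬝ᵥ x ∧
        ∀ a, atom a ⬝ᵥ atom a ≤ 1 → atom a ⬝ᵥ (x - ∑ i, τ • atom (g i)) ≤ τ := by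
  have hnn : ∀ x : ι → ℝ, 0 ≤ x ⬝ᵥ x := fun x =>
    Finset.sum_nonneg fun i _ => mul_self_nonneg (x i)
  intro N
  induction N with
  | zero =>
    intro x hx
    refine ⟨0, Fin.elim0, by simpa using hnn x, fun a _ => ?_⟩
    have hx0 : x ⬝ᵥ x = 0 := le_antisymm (by simpa using hx) (hnn x)
    simp [dotProduct_self_eq_zero.1 hx0, hτ.le]
  | succ N ih =>
    intro x hx
    by_cases hall : ∀ a, atom a ⬝ᵥ atom a ≤ 1 → atom a ⬝ᵥ x ≤ τ
    · exact ⟨0, Fin.elim0, by simpa using hnn x, by simpa using hall⟩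
    push Not at hall
    obtain ⟨a, ha1, ha⟩ := hall
    -- Expanding the square, the cross term contributes less than -2τ² and the atom itself at most
    -- τ².
    have hy : (x - τ • atom a) ⬝ᵥ (x - τ • atom a) ≤ x ⬝ᵥ x - τ ^ 2 := by
      simp only [sub_dotProduct, dotProduct_sub, smul_dotProduct, dotProduct_smul, smul_eq_mul,
        dotProduct_comm x (atom a)]
      nlinarith [mul_lt_mul_of_pos_left ha hτ, mul_le_mul_of_nonneg_left ha1 (sq_nonneg τ)]
    obtain ⟨r, g, hr, hg⟩ := ih (x - τ • atom a) (by push_cast at hx; linarith)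
    refine ⟨r + 1, Fin.cons a g, by push_cast; linarith, fun b hb => ?_⟩
    have := hg b hb
    rw [Fin.sum_univ_succ]
    simpa [sub_sub] using this

/-- The point of the grid `(4h)⁻¹ ℤ ∩ [-1, 1]` with number `c`. -/
noncomputable def gridPoint (h : ℕ) (c : Fin (8 * h + 1)) : ℝ := ((c : ℝ) - 4 * h) / (4 * h)

/-- Rounding toward zero never increases the absolute value, so rounded vectors stay in the unit
ball. -/
lemma exists_gridPoint {h : ℕ} (hh : 0 < h) {t : ℝ} (ht : |t| ≤ 1) :
    ∃ c, |gridPoint h c| ≤ |t| ∧ |t - gridPoint h c| ≤ 1 / (4 * h) := by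
  have hh' : (0 : ℝ) < 4 * h := by positivity
  have key : ∀ s : ℝ, 0 ≤ s → s ≤ 1 → ∃ k : ℕ, k ≤ 4 * h ∧ (k : ℝ) / (4 * h) ≤ s ∧
      s - k / (4 * h) ≤ 1 / (4 * h) := by
    intro s hs hs1
    refine ⟨⌊4 * h * s⌋₊, ?_, ?_, ?_⟩
    · rw [← Nat.cast_le (α := ℝ)]
      refine (Nat.floor_le (by positivity)).trans ?_
      push_cast
      nlinarith
    · rw [div_le_iff₀ hh', mul_comm s]
      exact Nat.floor_le (by positivity)
    · rw [sub_le_iff_le_add, ← add_div, le_div_iff₀ hh', mul_comm s, add_comm]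
      exact (Nat.lt_floor_add_one _).le
  rcases le_total 0 t with h0 | h0
  · rw [abs_of_nonneg h0] at ht ⊢
    obtain ⟨k, hk, h1, h2⟩ := key t h0 ht
    have e : gridPoint h ⟨4 * h + k, by omega⟩ = k / (4 * h) := by
      simp [gridPoint]
    refine ⟨_, by rw [e, abs_of_nonneg (by positivity)]; exact h1, ?_⟩
    rw [e, abs_of_nonneg (by linarith)]
    exact h2
  · rw [abs_of_nonpos h0] at ht ⊢
    obtain ⟨k, hk, h1, h2⟩ := key (-t) (by linarith) ht
    have e : gridPoint h ⟨4 * h - k, by omega⟩ = -(k / (4 * h)) := by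
      simp only [gridPoint]
      rw [Nat.cast_sub hk]
      push_cast
      ring
    refine ⟨_, by rw [e, abs_neg, abs_of_nonneg (by positivity)]; exact h1, ?_⟩
    rw [e, abs_of_nonpos (by linarith)]
    linarith

lemma exists_gridVec {h p : ℕ} (hp : p ≤ h) (hh : 0 < h) {x : Fin p → ℝ} (hx : ∑ i, x i ^ 2 ≤ 1) :
    ∃ c : Fin p → Fin (8 * h + 1), ∑ i, gridPoint h (c i) ^ 2 ≤ 1 ∧
      ∑ i, (x i - gridPoint h (c i)) ^ 2 ≤ (1 / 4) ^ 2 := by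
  have hx1 : ∀ i, |x i| ≤ 1 := fun i => by
    rw [← sq_le_one_iff_abs_le_one]
    exact (Finset.single_le_sum (fun j _ => sq_nonneg (x j)) (Finset.mem_univ i)).trans hx
  choose c hc1 hc2 using fun i => exists_gridPoint hh (hx1 i)
  refine ⟨c, (Finset.sum_le_sum fun i _ => sq_le_sq.2 (hc1 i)).trans hx, ?_⟩
  have hh' : (1 : ℝ) ≤ h := by exact_mod_cast hh
  have hp' : (p : ℝ) ≤ h := by exact_mod_cast hp
  calc ∑ i, (x i - gridPoint h (c i)) ^ 2 ≤ ∑ _i : Fin p, (1 / (4 * (h : ℝ))) ^ 2 :=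
        Finset.sum_le_sum fun i _ => sq_le_sq.2 (by
          rw [abs_of_nonneg (by positivity : (0 : ℝ) ≤ 1 / (4 * h))]; exact hc2 i)
    _ = p * (1 / (4 * (h : ℝ))) ^ 2 := by simp
    _ ≤ (1 / 4) ^ 2 := by
        rw [div_pow, one_pow, mul_one_div, div_le_iff₀ (by positivity)]
        nlinarith

/-- The usual net argument: replacing both unit vectors by grid vectors at distance at most 1/4
costs at most ‖M‖₂/2, which is absorbed on the left. -/
lemma specNorm_le_of_grid {h p q : ℕ} (hp : p ≤ h) (hq : q ≤ h) (hh : 0 < h)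
    {M : Matrix (Fin p) (Fin q) ℝ} {τ : ℝ} (hτ : 0 ≤ τ)
    (H : ∀ (u : Fin p → Fin (8 * h + 1)) (v : Fin q → Fin (8 * h + 1)),
      ∑ i, gridPoint h (u i) ^ 2 ≤ 1 → ∑ j, gridPoint h (v j) ^ 2 ≤ 1 →
        (fun i => gridPoint h (u i)) ⬝ᵥ (M *ᵥ fun j => gridPoint h (v j)) ≤ τ) :
    specNorm M ≤ 2 * τ := by
  have hN := specNorm_nonneg M
  have hmul : ∀ (y : Fin q → ℝ) {b : ℝ}, 0 ≤ b → ∑ j, y j ^ 2 ≤ b ^ 2 →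
      ∑ i, (M *ᵥ y) i ^ 2 ≤ (specNorm M * b) ^ 2 := fun y b _ hy =>
    (sum_mulVec_sq_le M y).trans (by rw [mul_pow]; gcongr)
  have : specNorm M ≤ τ + specNorm M / 2 := by
    refine specNorm_le_of_bilin (by positivity) fun x y hx hy => ?_
    obtain ⟨u, hu, hxu⟩ := exists_gridVec hp hh hx
    obtain ⟨v, hv, hyv⟩ := exists_gridVec hq hh hy
    set U : Fin p → ℝ := fun i => gridPoint h (u i)
    set V : Fin q → ℝ := fun j => gridPoint h (v j)
    have e : x ⬝ᵥ (M *ᵥ y) = U ⬝ᵥ (M *ᵥ V) + (x - U) ⬝ᵥ (M *ᵥ V) + x ⬝ᵥ (M *ᵥ (y - V)) := by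
      rw [Matrix.mulVec_sub, sub_dotProduct, dotProduct_sub]; ring
    have h1 : (x - U) ⬝ᵥ (M *ᵥ V) ≤ 1 / 4 * (specNorm M * 1) :=
      dotProduct_le_of_sq_le (by norm_num) (by positivity) hxu
        (hmul V zero_le_one (by simpa using hv))
    have h2 : x ⬝ᵥ (M *ᵥ (y - V)) ≤ 1 * (specNorm M * (1 / 4)) :=
      dotProduct_le_of_sq_le zero_le_one (by positivity) (by simpa using hx)
        (hmul (y - V) (by norm_num) hyv)
    rw [e]
    linarith [H u v hu hv]
  linarith

/-- Codes of the rank-one atoms: a layer and a grid point of each of the two unit cubes. -/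
abbrev AtomCode (L : ℕ) (d : ℕ → ℕ) (h : ℕ) : Type :=
  Σ k : Fin (L + 1), (Fin (d k) → Fin (8 * h + 1)) × (Fin (d (k + 1)) → Fin (8 * h + 1))

/-- The parameters with a single nonzero layer, of rank one, described by a code. -/
noncomputable def atomWeights {L : ℕ} {d : ℕ → ℕ} {h : ℕ} (a : AtomCode L d h) : Weights L d :=
  Pi.single a.1 (Matrix.vecMulVec (fun i => gridPoint h (a.2.1 i)) (fun j => gridPoint h (a.2.2 j)))

/-- The list of all entries of the weight matrices. -/
def flatten {L : ℕ} {d : ℕ → ℕ} (W : Weights L d) :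
    (Σ k : Fin (L + 1), Fin (d k) × Fin (d (k + 1))) → ℝ := fun x => W x.1 x.2.1 x.2.2

lemma flatten_dotProduct {L : ℕ} {d : ℕ → ℕ} (V W : Weights L d) :
    flatten V ⬝ᵥ flatten W = ∑ k, ∑ i, ∑ j, V k i j * W k i j := by
  simp only [dotProduct, flatten, Fintype.sum_sigma, Fintype.sum_prod_type]

/-- Correlation with an atom is the bilinear form of one layer, so the stopping rule of matching
pursuit is exactly the hypothesis of `specNorm_le_of_grid`. -/
lemma flatten_atomWeights_dotProduct {L : ℕ} {d : ℕ → ℕ} {h : ℕ} (a : AtomCode L d h)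
    (W : Weights L d) : flatten (atomWeights a) ⬝ᵥ flatten W
      = (fun i => gridPoint h (a.2.1 i)) ⬝ᵥ (W a.1 *ᵥ fun j => gridPoint h (a.2.2 j)) := by
  rw [flatten_dotProduct, Finset.sum_eq_single a.1]
  · simp only [atomWeights, Pi.single_eq_same, Matrix.vecMulVec_apply, dotProduct, Matrix.mulVec,
      Finset.mul_sum]
    exact Finset.sum_congr rfl fun i _ => Finset.sum_congr rfl fun j _ => by ring
  · intro k _ hk
    simp [atomWeights, Pi.single_eq_of_ne hk]
  · simp

lemma flatten_atomWeights_self {L : ℕ} {d : ℕ → ℕ} {h : ℕ} (a : AtomCode L d h) :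
    flatten (atomWeights a) ⬝ᵥ flatten (atomWeights a)
      = (∑ i, gridPoint h (a.2.1 i) ^ 2) * ∑ j, gridPoint h (a.2.2 j) ^ 2 := by
  rw [flatten_atomWeights_dotProduct]
  simp only [atomWeights, Pi.single_eq_same, Matrix.vecMulVec_apply, dotProduct, Matrix.mulVec,
      Finset.mul_sum, Finset.sum_mul]
  rw [Finset.sum_comm]
  exact Finset.sum_congr rfl fun i _ => Finset.sum_congr rfl fun j _ => by ring

/-- Sparse approximation in spectral norm: with `r ≤ τ⁻² ∑ ‖W k‖_F²` rank-one atoms all layers are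
approximated up to `2 τ`. -/
lemma exists_atom_approx {L : ℕ} {d : ℕ → ℕ} {h : ℕ} (hh : 0 < h) (hd : ∀ k ≤ L + 1, d k ≤ h)
    (W : Weights L d) {τ : ℝ} (hτ : 0 < τ) :
    ∃ (r : ℕ) (g : Fin r → AtomCode L d h), r * τ ^ 2 ≤ ∑ k, frobNorm (W k) ^ 2 ∧
      ∀ k, specNorm (W k - (∑ i, τ • atomWeights (g i)) k) ≤ 2 * τ := by
  have hF : flatten W ⬝ᵥ flatten W = ∑ k, frobNorm (W k) ^ 2 := by
    rw [flatten_dotProduct]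
    simp_rw [frobNorm_sq, sq]
  obtain ⟨N, hN⟩ := exists_nat_ge ((flatten W ⬝ᵥ flatten W) / τ ^ 2)
  rw [div_le_iff₀ (by positivity)] at hN
  obtain ⟨r, g, hr, hg⟩ :=
    exists_sum_atoms (fun a : AtomCode L d h => flatten (atomWeights a)) hτ N _ hN
  refine ⟨r, g, hF ▸ hr, fun k => ?_⟩
  refine specNorm_le_of_grid (hd k (by omega)) (hd (k + 1) (by omega)) hh hτ.le fun u v hu hv => ?_
  have e : flatten W - ∑ i, τ • flatten (atomWeights (g i))
      = flatten (W - ∑ i, τ • atomWeights (g i)) := by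
    ext x
    simp [flatten, Finset.sum_apply, Matrix.sum_apply]
  have := hg ⟨k, u, v⟩ (by
    rw [flatten_atomWeights_self]
    exact mul_le_one₀ hu (by positivity) hv)
  rwa [e, flatten_atomWeights_dotProduct] at this

lemma card_atomCode_le {L : ℕ} {d : ℕ → ℕ} {h : ℕ} (hd : ∀ k ≤ L + 1, d k ≤ h) :
    Fintype.card (AtomCode L d h) ≤ (L + 1) * (8 * h + 1) ^ (2 * h) := by
  rw [Fintype.card_sigma]
  calc _ ≤ ∑ _k : Fin (L + 1), (8 * h + 1) ^ (2 * h) := by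
        refine Finset.sum_le_sum fun k _ => ?_
        rw [Fintype.card_prod, Fintype.card_fun, Fintype.card_fun, Fintype.card_fin,
          Fintype.card_fin, Fintype.card_fin, ← pow_add, two_mul]
        exact Nat.pow_le_pow_right (by omega)
          (add_le_add (hd k (by omega)) (hd (k + 1) (by omega)))
    _ = _ := by simp

/-! ### Measurability of the margin. -/

section Measurability

variable {L : ℕ} {d : ℕ → ℕ}

lemma measurable_laplacian_apply {n : ℕ} (i j : Fin n) :
    Measurable fun A : Fin n → Fin n → ℝ => laplacian (Matrix.of A) i j := by
  simp only [laplacian, Matrix.mul_diagonal, Matrix.diagonal_mul, Matrix.add_apply, Matrix.of_apply]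
  fun_prop

lemma measurable_nodeRep_apply (W : Weights L d) (n : ℕ+) :
    ∀ (k : ℕ) (hk : k ≤ L) (i : Fin n) (j : Fin (d k)),
      Measurable fun p : (Fin n → Fin (d 0) → ℝ) × (Fin n → Fin n → ℝ) =>
        (nodeRep W (⟨n, p⟩ : GraphData (d 0)) k hk : Matrix (Fin n) (Fin (d k)) ℝ) i j
  | 0, _, i, j => by
    simp only [nodeRep, GraphData.X, Matrix.of_apply]
    fun_prop
  | k + 1, hk, i, j => by
    have ih := measurable_nodeRep_apply W n k (Nat.le_of_succ_le hk)
    simp only [nodeRep, Matrix.map_apply, Matrix.mul_apply]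
    refine measurable_const.max ?_
    apply Finset.measurable_fun_sum
    intro b _
    apply Measurable.mul_const
    refine Finset.measurable_fun_sum (ι := Fin n) Finset.univ fun c _ => ?_
    exact Measurable.fun_mul ((measurable_laplacian_apply i c).comp measurable_snd) (ih c b)

lemma measurable_output_apply (W : Weights L d) (j : Fin (d (L + 1))) :
    Measurable fun G : GraphData (d 0) => output W G j := by
  intro s hs
  rw [Sigma.instMeasurableSpace, MeasurableSpace.measurableSet_iInf]
  intro n
  rw [MeasurableSpace.map_def]
  have : Measurable fun p : (Fin n → Fin (d 0) → ℝ) × (Fin n → Fin n → ℝ) =>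
      output W (⟨n, p⟩ : GraphData (d 0)) j := by
    simp only [output, Matrix.vecMul, dotProduct, Matrix.mul_apply]
    refine Finset.measurable_fun_sum (ι := Fin n) Finset.univ fun i _ => ?_
    apply Measurable.const_mul
    apply Finset.measurable_fun_sum
    intro b _
    exact (measurable_nodeRep_apply W n L le_rfl i b).mul_const _
  exact this hs

lemma measurable_margin (W : Weights L d) :
    Measurable fun z : GraphData (d 0) × Fin (d (L + 1)) => margin W z := by
  refine measurable_from_prod_countable_left fun y => ?_
  simp only [margin]
  exact (measurable_output_apply W y).sub (Measurable.iSup fun j => measurable_output_apply W j)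

end Measurability

/-! ### Concentration and the union bound over codes. -/

/-- One-sided Hoeffding bound for the frequency of an event in an i.i.d. sample. -/
lemma measure_freq_add_lt_le {Ω : Type*} [MeasurableSpace Ω] (D : Measure Ω)
    [IsProbabilityMeasure D] {E : Set Ω} (hE : MeasurableSet E) {m : ℕ} (hm : 1 ≤ m) {t : ℝ}
    (ht : 0 ≤ t) :
    Measure.pi (fun _ : Fin m => D)
      {S | (1 / (m : ℝ)) * ∑ i, E.indicator (fun _ => (1 : ℝ)) (S i) + t < D.real E}
      ≤ ENNReal.ofReal (Real.exp (-(2 * m * t ^ 2))) := by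
  have hm0 : (0 : ℝ) < m := by exact_mod_cast hm
  set P := Measure.pi (fun _ : Fin m => D)
  -- The sign turns a frequency that is too low into an upper-tail event; values in [-1, 0] give
  -- sub-Gaussian parameter 1/4.
  set Y : Ω → ℝ := fun z => -E.indicator (fun _ => (1 : ℝ)) z with hY
  have hYm : Measurable Y := (measurable_const.indicator hE).neg
  have hint : ∫ z, Y z ∂D = -D.real E := by
    rw [hY, integral_neg, integral_indicator_const _ hE, smul_eq_mul, mul_one]
  have hsub : ∀ i : Fin m, ProbabilityTheory.HasSubgaussianMGF
      (fun S : Fin m → Ω => Y (S i) - ∫ z, Y z ∂D) ((‖(0 : ℝ) - (-1)‖₊ / 2) ^ 2) P := by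
    intro i
    have h := ProbabilityTheory.hasSubgaussianMGF_of_mem_Icc (μ := P) (a := -1) (b := 0)
      (X := fun S : Fin m → Ω => Y (S i)) (hYm.comp (measurable_pi_apply i)).aemeasurable
      (Filter.Eventually.of_forall fun S => by
        simp only [hY]
        by_cases hS : S i ∈ E <;> simp [hS])
    have he : ∫ S, Y (S i) ∂P = ∫ z, Y z ∂D :=
      integral_comp_eval (μ := fun _ : Fin m => D) hYm.aestronglyMeasurable
    rwa [he] at h
  have hind : ProbabilityTheory.iIndepFun
      (fun (i : Fin m) (S : Fin m → Ω) => Y (S i) - ∫ z, Y z ∂D) P :=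
    ProbabilityTheory.iIndepFun_pi (X := fun (_ : Fin m) z => Y z - ∫ z, Y z ∂D)
      fun _ => (hYm.sub_const _).aemeasurable
  have key := ProbabilityTheory.HasSubgaussianMGF.measure_sum_ge_le_of_iIndepFun hind
    (s := Finset.univ) (fun i _ => hsub i) (ε := m * t) (by positivity)
  have hexp : -(m * t : ℝ) ^ 2 / (2 * ((∑ _i : Fin m, (‖(0 : ℝ) - (-1)‖₊ / 2) ^ 2 : NNReal) : ℝ))
      = -(2 * m * t ^ 2) := by
    simp
    field_simp
  push_cast at key hexp
  rw [hexp] at key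
  rw [← ENNReal.ofReal_toReal (measure_ne_top P _)]
  refine ENNReal.ofReal_le_ofReal (le_trans ?_ key)
  refine measureReal_mono (fun S hS => ?_)
  simp only [Set.mem_ofPred_eq, hint] at hS ⊢
  simp only [hY]
  rw [Finset.sum_sub_distrib, Finset.sum_neg_distrib]
  simp only [Finset.sum_const, Finset.card_univ, Fintype.card_fin, nsmul_eq_mul]
  have := mul_lt_mul_of_pos_left hS hm0
  rw [mul_add, ← mul_assoc, mul_one_div_cancel hm0.ne', one_mul] at this
  linarith

/-- Hoeffding's bound and a weighted union bound over events indexed by a number and a word. -/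
lemma measure_exists_freq_add_lt_le {Ω α : Type*} [MeasurableSpace Ω] [Fintype α] [Nonempty α]
    (D : Measure Ω) [IsProbabilityMeasure D] (E : ℕ → (r : ℕ) → (Fin r → α) → Set Ω)
    (hE : ∀ a r g, MeasurableSet (E a r g)) {m : ℕ} (hm : 1 ≤ m) {δ : ℝ} (hδ : 0 < δ)
    (hδ1 : δ < 1) :
    Measure.pi (fun _ : Fin m => D)
      {S | ∃ a r g, (1 / (m : ℝ)) * ∑ i, (E a r g).indicator (fun _ => (1 : ℝ)) (S i)
        + √((Real.log (1 / δ) + (a + r + 2) * Real.log 2 + r * Real.log (Fintype.card α))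
          / (2 * m)) < D.real (E a r g)}
      ≤ ENNReal.ofReal δ := by
  have hm0 : (0 : ℝ) < m := by exact_mod_cast hm
  have hN : (1 : ℝ) ≤ Fintype.card α := by exact_mod_cast Fintype.card_pos
  have hN0 : (0 : ℝ) < Fintype.card α := by linarith
  set N : ℝ := (Fintype.card α : ℝ)
  set P := Measure.pi (fun _ : Fin m => D)
  set bad : (a r : ℕ) → (Fin r → α) → Set (Fin m → Ω) := fun a r g =>
    {S | (1 / (m : ℝ)) * ∑ i, (E a r g).indicator (fun _ => (1 : ℝ)) (S i)
      + √((Real.log (1 / δ) + (a + r + 2) * Real.log 2 + r * Real.log N) / (2 * m))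
        < D.real (E a r g)} with hbad
  -- The code (a, r, g) receives the share δ · 2^{-(a+1)} · 2^{-(r+1)} · N^{-r}; these shares sum to
  -- δ.
  have h1 : ∀ a r g, P (bad a r g) ≤ ENNReal.ofReal (δ / 2 / 2 ^ a / 2 / 2 ^ r / N ^ r) := by
    intro a r g
    refine (measure_freq_add_lt_le D (hE a r g) hm (Real.sqrt_nonneg _)).trans
      (ENNReal.ofReal_le_ofReal (le_of_eq ?_))
    have hl : 0 ≤ Real.log (1 / δ) := Real.log_nonneg (by rw [le_div_iff₀ hδ]; linarith)
    have hl2 : 0 ≤ Real.log 2 := Real.log_nonneg (by norm_num)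
    have hl3 : 0 ≤ Real.log N := Real.log_nonneg hN
    rw [Real.sq_sqrt (by positivity), mul_div_cancel₀ _ (by positivity : (2 * m : ℝ) ≠ 0),
      ← Real.exp_log (show 0 < δ / 2 / 2 ^ a / 2 / 2 ^ r / N ^ r by positivity)]
    congr 1
    rw [Real.log_div (by positivity) (by positivity), Real.log_div (by positivity) (by positivity),
      Real.log_div (by positivity) (by positivity), Real.log_div (by positivity) (by positivity),
      Real.log_div (by positivity) (by positivity), Real.log_pow, Real.log_pow, Real.log_pow,
      Real.log_div (by positivity) (by positivity), Real.log_one]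
    ring
  have h2 : ∀ a r, P (⋃ g, bad a r g) ≤ ENNReal.ofReal (δ / 2 / 2 ^ a / 2 / 2 ^ r) := by
    intro a r
    refine (measure_iUnion_fintype_le P _).trans ((Finset.sum_le_sum fun g _ => h1 a r g).trans ?_)
    rw [Finset.sum_const, Finset.card_univ, Fintype.card_fun, Fintype.card_fin,
      ← ENNReal.ofReal_nsmul]
    refine ENNReal.ofReal_le_ofReal (le_of_eq ?_)
    rw [nsmul_eq_mul, Nat.cast_pow, mul_div_cancel₀ _ (by positivity)]
  have geom : ∀ c : ℝ, 0 ≤ c → ∑' n : ℕ, ENNReal.ofReal (c / 2 / 2 ^ n) = ENNReal.ofReal c := by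
    intro c hc
    rw [← ENNReal.ofReal_tsum_of_nonneg (fun n => by positivity) (summable_geometric_two' c),
      tsum_geometric_two']
  have h3 : ∀ a, P (⋃ r, ⋃ g, bad a r g) ≤ ENNReal.ofReal (δ / 2 / 2 ^ a) := fun a =>
    (measure_iUnion_le _).trans ((ENNReal.tsum_le_tsum fun r => h2 a r).trans
      (geom _ (by positivity)).le)
  have h4 : P (⋃ a, ⋃ r, ⋃ g, bad a r g) ≤ ENNReal.ofReal δ :=
    (measure_iUnion_le _).trans ((ENNReal.tsum_le_tsum fun a => h3 a).trans (geom _ hδ.le).le)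
  refine le_trans (measure_mono fun S hS => ?_) h4
  obtain ⟨a, r, g, h⟩ := hS
  exact Set.mem_iUnion.2 ⟨a, Set.mem_iUnion.2 ⟨r, Set.mem_iUnion.2 ⟨g, h⟩⟩⟩

/-! ### Margins and normalization of the layers. -/

/-- The margin of a score vector `v` at the class `y`. -/
noncomputable def marginOf {K : ℕ} (v : Fin K → ℝ) (y : Fin K) : ℝ :=
  v y - ⨆ j : {j : Fin K // j ≠ y}, v j

lemma marginOf_le_add {K : ℕ} (hK : 2 ≤ K) {v v' : Fin K → ℝ} {η : ℝ}
    (h : ∀ j, |v j - v' j| ≤ η) (y : Fin K) : marginOf v y ≤ marginOf v' y + 2 * η := by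
  have : Nontrivial (Fin K) := Fin.nontrivial_iff_two_le.2 hK
  have : Nonempty {j : Fin K // j ≠ y} := nonempty_subtype.2 (exists_ne y)
  have h1 : ⨆ j : {j : Fin K // j ≠ y}, v' j ≤ (⨆ j : {j : Fin K // j ≠ y}, v j) + η := by
    refine ciSup_le fun j => ?_
    have h2 := le_ciSup (f := fun j : {j : Fin K // j ≠ y} => v j) (Set.finite_range _).bddAbove j
    have h3 := (abs_le.1 (h j)).1
    beta_reduce at h2
    linarith
  have h4 := (abs_le.1 (h y)).2
  unfold marginOf
  linarith

lemma marginOf_const_mul {K : ℕ} {s : ℝ} (hs : 0 ≤ s) (v : Fin K → ℝ) (y : Fin K) :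
    marginOf (fun j => s * v j) y = s * marginOf v y := by
  unfold marginOf
  rw [mul_sub, Real.mul_iSup_of_nonneg hs]

section Normalization

variable {L : ℕ} {d : ℕ → ℕ}

/-- The weights with each layer divided by its spectral norm. -/
noncomputable def normalized (W : Weights L d) : Weights L d := fun k => (specNorm (W k))⁻¹ • W k

lemma specNorm_normalized_le (W : Weights L d) (k : Fin (L + 1)) :
    specNorm (normalized W k) ≤ 1 := by
  rw [normalized, specNorm_smul, abs_of_nonneg (inv_nonneg.2 (specNorm_nonneg _))]
  exact inv_mul_le_one

lemma frobNorm_normalized_sq (W : Weights L d) (k : Fin (L + 1)) :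
    frobNorm (normalized W k) ^ 2 = frobNorm (W k) ^ 2 / specNorm (W k) ^ 2 := by
  rw [normalized, frobNorm_smul, mul_pow, sq_abs, inv_pow, div_eq_inv_mul]

/-- This also holds when a layer vanishes: its normalization is then 0, and rescaling by 0 recovers
it. -/
lemma output_eq_prod_mul (W : Weights L d) (G : GraphData (d 0)) (j : Fin (d (L + 1))) :
    output W G j = (∏ k, specNorm (W k)) * output (normalized W) G j := by
  rw [← output_smul _ fun k => specNorm_nonneg (W k)]
  congr 1
  funext k
  by_cases h : specNorm (W k) = 0
  · rw [h, zero_smul, specNorm_eq_zero.1 h]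
  · rw [normalized, smul_smul, mul_inv_cancel₀ h, one_smul]

lemma complexity_eq (W : Weights L d) : complexity W
    = (∏ k, specNorm (W k)) ^ 2 * ∑ k, frobNorm (normalized W k) ^ 2 := by
  simp_rw [frobNorm_normalized_sq]
  rw [complexity, Finset.prod_pow]

/-- Each normalized layer has spectral norm 1, hence Frobenius norm at least 1. This lets the
complexity term absorb the additive costs of a code. -/
lemma le_sum_frobNorm_normalized_sq {W : Weights L d} (hW : ∏ k, specNorm (W k) ≠ 0) :
    ((L + 1 : ℕ) : ℝ) ≤ ∑ k, frobNorm (normalized W k) ^ 2 := by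
  have h : ∀ k, 1 ≤ frobNorm (normalized W k) ^ 2 := by
    intro k
    have hk : specNorm (W k) ≠ 0 := Finset.prod_ne_zero_iff.1 hW k (Finset.mem_univ k)
    have : specNorm (normalized W k) = 1 := by
      rw [normalized, specNorm_smul, abs_of_nonneg (inv_nonneg.2 (specNorm_nonneg _)),
        inv_mul_cancel₀ hk]
    exact one_le_pow₀ (this ▸ specNorm_le_frobNorm _)
  calc ((L + 1 : ℕ) : ℝ) = ∑ _k : Fin (L + 1), (1 : ℝ) := by simp
    _ ≤ _ := Finset.sum_le_sum fun k _ => h k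

lemma margin_le_of_prod_mul_le (hK : 2 ≤ d (L + 1)) {W : Weights L d} {B γ : ℝ}
    (hs : (∏ k, specNorm (W k)) * B ≤ γ / 2) {z : GraphData (d 0) × Fin (d (L + 1))}
    (hz : Admissible B z.1) : margin W z ≤ γ := by
  have h0 : marginOf (fun _ : Fin (d (L + 1)) => (0 : ℝ)) z.2 = 0 := by simp [marginOf]
  have hs0 : 0 ≤ ∏ k, specNorm (W k) := Finset.prod_nonneg fun _ _ => specNorm_nonneg _
  have h1 := marginOf_le_add hK (v := output W z.1) (v' := fun _ => 0) (η := γ / 2) (fun j => by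
    rw [sub_zero, output_eq_prod_mul, abs_mul, abs_of_nonneg hs0]
    exact (mul_le_mul_of_nonneg_left (abs_output_le (specNorm_normalized_le W) hz j) hs0).trans hs)
    z.2
  rw [h0] at h1
  change marginOf (output W z.1) z.2 ≤ γ
  linarith

end Normalization

/-! ### Codes for networks and their cost. -/

section Cover

variable {L : ℕ} {d : ℕ → ℕ}

/-- The weights coded by a resolution `a` and a word `g` of atoms. -/
noncomputable def codedWeights {h : ℕ} (a : ℕ) {r : ℕ} (g : Fin r → AtomCode L d h) : Weights L d :=
  ∑ i, (1 / (4 * ((L + 1 : ℕ) : ℝ) * a)) • atomWeights (g i)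

lemma one_add_pow_sub_one_le {l : ℕ} (hl : 0 < l) {a : ℝ} (ha : 1 ≤ a) :
    (1 + 1 / (2 * l * a)) ^ l - 1 ≤ 1 / a := by
  have hl' : (0 : ℝ) < l := by exact_mod_cast hl
  have h1 : (1 + 1 / (2 * l * a)) ^ l ≤ Real.exp (1 / (2 * a)) := by
    calc (1 + 1 / (2 * l * a)) ^ l ≤ Real.exp (1 / (2 * l * a)) ^ l := by
          refine pow_le_pow_left₀ (by positivity) ?_ l
          rw [add_comm]; exact Real.add_one_le_exp _
      _ = Real.exp (1 / (2 * a)) := by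
          rw [← Real.exp_nat_mul]
          congr 1
          field_simp
  have h2 : |1 / (2 * a)| = 1 / (2 * a) := abs_of_nonneg (by positivity)
  have h3 := Real.abs_exp_sub_one_le (x := 1 / (2 * a)) (by
    rw [h2, div_le_one (by positivity)]; linarith)
  rw [h2] at h3
  have h4 : 2 * (1 / (2 * a)) = 1 / a := by field_simp
  linarith [le_abs_self (Real.exp (1 / (2 * a)) - 1)]

/-- Each network is approximated in margin, uniformly over the admissible graphs, by a multiple of
a network with a short code. -/
lemma exists_code {h : ℕ} (hh : 0 < h) (hd : ∀ k ≤ L + 1, d k ≤ h) (hK : 2 ≤ d (L + 1))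
    (W : Weights L d) {B γ : ℝ} (hγ : 0 < γ) (hs : γ / 2 < (∏ k, specNorm (W k)) * B) :
    ∃ (a r : ℕ) (g : Fin r → AtomCode L d h),
      (a : ℝ) ≤ 8 * ((∏ k, specNorm (W k)) * B / γ) + 1 ∧
      (r : ℝ) ≤ 16 * ((L + 1 : ℕ) : ℝ) ^ 2 * a ^ 2 * ∑ k, frobNorm (normalized W k) ^ 2 ∧
      ∀ z : GraphData (d 0) × Fin (d (L + 1)), Admissible B z.1 →
        |a * γ / (8 * B) * margin (codedWeights a g) z - margin W z| ≤ γ / 2 := by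
  set s := ∏ k, specNorm (W k) with hs_def
  have hs0 : 0 ≤ s := Finset.prod_nonneg fun _ _ => specNorm_nonneg _
  -- B is an arbitrary real; positivity is forced by `hs`.
  have hB : 0 < B := by
    by_contra hB
    nlinarith [mul_nonneg hs0 (neg_nonneg.2 (not_lt.1 hB))]
  have hu : 0 < 8 * (s * B / γ) := by
    have : 0 < s * B := by linarith
    positivity
  -- The integer a encodes the scale s to within γ/(8B), and also sets the resolution of the atoms.
  set a := ⌈8 * (s * B / γ)⌉₊ with ha_def
  have ha1 : 8 * (s * B / γ) ≤ a := Nat.le_ceil _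
  have ha2 : (a : ℝ) < 8 * (s * B / γ) + 1 := Nat.ceil_lt_add_one hu.le
  have ha : (1 : ℝ) ≤ a := by exact_mod_cast Nat.ceil_pos.2 hu
  have ha0 : (0 : ℝ) < a := by linarith
  have hl : (0 : ℝ) < ((L + 1 : ℕ) : ℝ) := by positivity
  -- With this τ each layer is off by at most 2τ = 1/(2la), so by `one_add_pow_sub_one_le` the
  -- outputs move by at most B/a.
  obtain ⟨r, g, hr, hg⟩ := exists_atom_approx hh hd (normalized W)
    (τ := 1 / (4 * ((L + 1 : ℕ) : ℝ) * a)) (by positivity)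
  refine ⟨a, r, g, ha2.le, ?_, fun z hz => ?_⟩
  · rw [div_pow, one_pow, mul_one_div, div_le_iff₀ (by positivity)] at hr
    linarith
  have hg' : ∀ k, specNorm (normalized W k - codedWeights a g k)
      ≤ 1 / (2 * ((L + 1 : ℕ) : ℝ) * a) := fun k => (hg k).trans (le_of_eq (by field_simp; norm_num))
  have hs' : 0 ≤ a * γ / (8 * B) := by positivity
  have hdiff : |a * γ / (8 * B) - s| ≤ γ / (8 * B) := by
    rw [abs_le]
    have e1 : s = (8 * (s * B / γ)) * (γ / (8 * B)) := by field_simp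
    have e2 : a * γ / (8 * B) = a * (γ / (8 * B)) := by ring
    have e3 : 0 < γ / (8 * B) := by positivity
    rw [e2]
    constructor <;> nlinarith
  have hclose : ∀ j, |a * γ / (8 * B) * output (codedWeights a g) z.1 j - output W z.1 j|
      ≤ γ / 4 := by
    intro j
    have h1 := abs_output_le (specNorm_normalized_le W) hz j
    have h2 := abs_output_sub_le (by positivity) (specNorm_normalized_le W) hg' hz j
    have h3 := one_add_pow_sub_one_le L.succ_pos ha
    have h4 : |output (normalized W) z.1 j - output (codedWeights a g) z.1 j| ≤ 1 / a * B :=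
      h2.trans (mul_le_mul_of_nonneg_right h3 hB.le)
    rw [output_eq_prod_mul W, ← hs_def]
    set f := output (normalized W) z.1 j
    set f' := output (codedWeights a g) z.1 j
    -- The error in the scale and the error in the weights contribute γ/8 each; the margin later
    -- doubles the total γ/4.
    calc |a * γ / (8 * B) * f' - s * f|
        = |(a * γ / (8 * B) - s) * f - a * γ / (8 * B) * (f - f')| := by congr 1; ring
      _ ≤ |a * γ / (8 * B) - s| * |f| + a * γ / (8 * B) * |f - f'| := by
          refine (abs_sub _ _).trans (le_of_eq ?_)
          rw [abs_mul, abs_mul, abs_of_nonneg hs']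
      _ ≤ γ / (8 * B) * B + a * γ / (8 * B) * (1 / a * B) := by gcongr
      _ = γ / 4 := by field_simp; norm_num
  have hm1 := marginOf_le_add hK hclose z.2
  have hm2 := marginOf_le_add hK (fun j => (abs_sub_comm _ _).trans_le (hclose j)) z.2
  rw [marginOf_const_mul hs'] at hm1 hm2
  change |a * γ / (8 * B) * marginOf (output (codedWeights a g) z.1) z.2
    - marginOf (output W z.1) z.2| ≤ γ / 2
  rw [abs_le]
  constructor <;> linarith

lemma log_card_atomCode_le {h : ℕ} (hh : 2 ≤ h) (hd : ∀ k ≤ L + 1, d k ≤ h)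
    [Nonempty (AtomCode L d h)] :
    Real.log (Fintype.card (AtomCode L d h))
      ≤ 10 * h * Real.log (((L + 1 : ℕ) : ℝ) * h) := by
  have hh' : (2 : ℝ) ≤ h := by exact_mod_cast hh
  have hl' : (1 : ℝ) ≤ ((L + 1 : ℕ) : ℝ) := by exact_mod_cast L.succ_pos
  have h1 : (Fintype.card (AtomCode L d h) : ℝ)
      ≤ ((L + 1 : ℕ) : ℝ) * (8 * h + 1) ^ (2 * h) := by
    exact_mod_cast card_atomCode_le hd
  have h2 : (0 : ℝ) < Fintype.card (AtomCode L d h) := by exact_mod_cast Fintype.card_pos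
  have h3 : (8 * h + 1 : ℝ) ≤ h ^ 5 := by
    have : (16 : ℝ) ≤ h ^ 4 := by
      calc (16 : ℝ) = 2 ^ 4 := by norm_num
        _ ≤ h ^ 4 := by gcongr
    nlinarith
  have h4 : Real.log (8 * h + 1) ≤ 5 * Real.log h := by
    refine (Real.log_le_log (by positivity) h3).trans (le_of_eq ?_)
    rw [Real.log_pow]; norm_num
  refine (Real.log_le_log h2 h1).trans ?_
  rw [Real.log_mul (by positivity) (by positivity), Real.log_pow,
    Real.log_mul (by positivity) (by positivity)]
  push_cast at *
  have h5 : 0 ≤ Real.log (L + 1) := Real.log_nonneg hl'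
  nlinarith [mul_le_mul_of_nonneg_left h4 (by positivity : (0 : ℝ) ≤ 2 * h)]

end Cover

/-- The cost of a code, in terms of `u = B ∏ ‖Wᵢ‖₂ / γ` and `F = ∑ ‖Wᵢ‖_F² / ‖Wᵢ‖₂²`. -/
lemma code_cost_le {l h u F a r N : ℝ} (hl : 1 ≤ l) (hh : 2 ≤ h) (hlh : 4 ≤ l * h)
    (hu : 1 / 2 ≤ u) (hF : 1 ≤ F) (ha0 : 0 ≤ a) (ha : a ≤ 8 * u + 1) (hr0 : 0 ≤ r)
    (hr : r ≤ 16 * l ^ 2 * a ^ 2 * F) (hN : N ≤ 10 * h * Real.log (l * h)) :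
    (a + r + 2) * Real.log 2 + r * N
      ≤ 20000 * (u ^ 2 * l ^ 2 * h * Real.log (l * h) * F) := by
  have hlog2 : Real.log 2 ≤ 1 := by linarith [Real.log_two_lt_d9]
  have hlog2' : 0 ≤ Real.log 2 := Real.log_nonneg (by norm_num)
  set Λ := Real.log (l * h) with hΛ_def
  have hΛ : 1 ≤ Λ := by
    have h1 : Real.log 4 ≤ Λ := Real.log_le_log (by norm_num) hlh
    have h2 : Real.log 4 = 2 * Real.log 2 := by
      rw [show (4 : ℝ) = 2 ^ 2 by norm_num, Real.log_pow]; norm_num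
    linarith [Real.log_two_gt_d9]
  have hl2 : 1 ≤ l ^ 2 := one_le_pow₀ hl
  have hhΛ : 1 ≤ h * Λ := by nlinarith
  -- Here u ≥ 1/2 absorbs the 1 from the ceiling, and it lets u² dominate the constant and linear
  -- terms below.
  have ha' : a ≤ 10 * u := by linarith
  have ha2 : a ^ 2 ≤ 100 * u ^ 2 := by
    calc a ^ 2 ≤ (10 * u) ^ 2 := pow_le_pow_left₀ ha0 ha' 2
      _ = _ := by ring
  have hr' : r ≤ 1600 * (u ^ 2 * l ^ 2 * F) := by
    calc r ≤ 16 * l ^ 2 * a ^ 2 * F := hr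
      _ ≤ 16 * l ^ 2 * (100 * u ^ 2) * F := by gcongr
      _ = _ := by ring
  have e1 : r * (Real.log 2 + N) ≤ 1600 * (u ^ 2 * l ^ 2 * F) * (11 * (h * Λ)) := by
    calc r * (Real.log 2 + N) ≤ r * (11 * (h * Λ)) :=
          mul_le_mul_of_nonneg_left (by linarith) hr0
      _ ≤ _ := mul_le_mul_of_nonneg_right hr' (by positivity)
  have e2 : (a + 2) * Real.log 2 ≤ 28 * u ^ 2 := by
    calc (a + 2) * Real.log 2 ≤ (a + 2) * 1 := by gcongr
      _ ≤ 28 * u ^ 2 := by nlinarith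
  have e3 : u ^ 2 ≤ u ^ 2 * (l ^ 2 * (h * Λ) * F) :=
    le_mul_of_one_le_right (sq_nonneg u)
      (one_le_mul_of_one_le_of_one_le (one_le_mul_of_one_le_of_one_le hl2 hhΛ) hF)
  have e4 : 0 ≤ u ^ 2 * (l ^ 2 * (h * Λ) * F) := by positivity
  nlinarith

/-- The deviation term of a code is at most the claimed one. -/
lemma sqrt_code_cost_le {T q R δ γ lm m Q : ℝ} (hδ : 0 < δ) (hδ1 : δ < 1) (hγ : 0 < γ)
    (hm : 0 < m) (hlm : 1 ≤ lm) (hT : T ≤ 20000 * q) (hq : Q = q * γ ^ 2)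
    (hR : R = (Q + max 1 (γ ^ 2) * Real.log (lm / δ)) / (γ ^ 2 * m)) :
    √((Real.log (1 / δ) + T) / (2 * m)) ≤ 100 * √R := by
  have h1 : 0 ≤ Real.log (1 / δ) := Real.log_nonneg (by rw [le_div_iff₀ hδ]; linarith)
  have h2 : Real.log (1 / δ) ≤ Real.log (lm / δ) :=
    Real.log_le_log (by positivity) (by gcongr)
  -- The confidence term is divided by γ² in the target bound, so max(1, γ²) is needed when γ > 1.
  have h3 : γ ^ 2 * Real.log (1 / δ) ≤ max 1 (γ ^ 2) * Real.log (lm / δ) :=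
    mul_le_mul (le_max_right _ _) h2 h1 (by positivity)
  have h4 : (q + Real.log (1 / δ)) / m ≤ R := by
    rw [hR, hq, div_le_div_iff₀ hm (by positivity)]
    nlinarith [mul_le_mul_of_nonneg_right h3 hm.le]
  have h5 : (100 : ℝ) * √R = √(100 ^ 2 * R) := by
    rw [Real.sqrt_mul (by norm_num), Real.sqrt_sq (by norm_num)]
  rw [h5]
  refine Real.sqrt_le_sqrt ?_
  calc (Real.log (1 / δ) + T) / (2 * m) ≤ 100 ^ 2 * ((q + Real.log (1 / δ)) / m) := by
        rw [← mul_div_assoc, div_le_div_iff₀ (by positivity) hm]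
        nlinarith
    _ ≤ _ := by gcongr

end GCN

/-! ### The generalization bound. -/

theorem theorem1 :
    ∃ C : ℝ, 0 < C ∧
      ∀ (L : ℕ) (_ : 1 ≤ L) (d : ℕ → ℕ) (_ : 2 ≤ d (L + 1))
        (h : ℕ) (_ : ∀ k ≤ L + 1, d k ≤ h) (B : ℝ)
        (D : Measure (GCN.GraphData (d 0) × Fin (d (L + 1)))) (_ : IsProbabilityMeasure D)
        (_ : ∀ᵐ z ∂D, GCN.Admissible B z.1)
        (δ γ : ℝ) (_ : 0 < δ) (_ : 0 < γ) (m : ℕ) (_ : 1 ≤ m),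
        Measure.pi (fun _ : Fin m => D)
          {S | ¬ ∀ W : GCN.Weights L d,
            GCN.expectedLoss D 0 W ≤ GCN.empiricalLoss S γ W +
              C * √((B ^ 2 * ((L + 1 : ℕ) : ℝ) ^ 2 * (h : ℝ)
                      * Real.log (((L + 1 : ℕ) : ℝ) * (h : ℝ)) * GCN.complexity W
                    + max 1 (γ ^ 2) * Real.log ((m : ℝ) * ((L + 1 : ℕ) : ℝ) / δ))
                  / (γ ^ 2 * (m : ℝ)))}
          ≤ ENNReal.ofReal δ := by
  -- 100² = 20000/2: the constant of `code_cost_le` over Hoeffding's factor 2.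
  refine ⟨100, by norm_num, ?_⟩
  intro L hL d hK h hd B D hD hadm δ γ hδ hγ m hm
  rcases le_or_gt 1 δ with hδ1 | hδ1
  · exact prob_le_one.trans (by simpa using ENNReal.ofReal_le_ofReal hδ1)
  have hh : 2 ≤ h := hK.trans (hd _ le_rfl)
  have hm0 : (0 : ℝ) < m := by exact_mod_cast hm
  have : Nonempty (GCN.AtomCode L d h) := ⟨⟨0, fun _ => 0, fun _ => 0⟩⟩
  have hadmS : ∀ᵐ S ∂(Measure.pi fun _ : Fin m => D), ∀ i, GCN.Admissible B (S i).1 :=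
    ae_all_iff.2 fun i => (Measure.quasiMeasurePreserving_eval (fun _ : Fin m => D) i).ae hadm
  refine le_trans (measure_mono_ae ?_) (GCN.measure_exists_freq_add_lt_le
    (α := GCN.AtomCode L d h) D (fun a r g => {z | a * γ / (8 * B) *
      GCN.margin (GCN.codedWeights a g) z ≤ γ / 2})
    (fun a r g => measurableSet_le ((GCN.measurable_margin _).const_mul _) measurable_const)
    hm hδ hδ1)
  filter_upwards [hadmS] with S hS hbad
  by_contra hgood
  refine hbad fun W => ?_
  set s := ∏ k, GCN.specNorm (W k) with hs_def
  -- The first case covers vanishing layers and B ≤ 0; the second provides s ≠ 0 and u = sB/γ > 1/2.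
  rcases le_or_gt (s * B) (γ / 2) with hsB | hsB
  · have hemp : GCN.empiricalLoss S γ W = 1 := by
      have : ∀ i, {z | GCN.margin W z ≤ γ}.indicator (fun _ => (1 : ℝ)) (S i) = 1 := fun i =>
        Set.indicator_of_mem (s := {z | GCN.margin W z ≤ γ})
          (GCN.margin_le_of_prod_mul_le hK hsB (hS i)) _
      simp [GCN.empiricalLoss, this, hm0.ne']
    rw [hemp]
    have h1 : GCN.expectedLoss D 0 W ≤ 1 := measureReal_le_one
    exact h1.trans (le_add_of_nonneg_right (by positivity))
  obtain ⟨a, r, g, ha, hr, hg⟩ := GCN.exists_code (by omega : 0 < h) hd hK W hγ hsB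
  have hs0 : s ≠ 0 := by rintro h0; rw [h0] at hsB; linarith
  have hF := GCN.le_sum_frobNorm_normalized_sq hs0
  set F := ∑ k, GCN.frobNorm (GCN.normalized W k) ^ 2
  have hl : (2 : ℝ) ≤ ((L + 1 : ℕ) : ℝ) := by exact_mod_cast Nat.succ_le_succ hL
  have hh' : (2 : ℝ) ≤ h := by exact_mod_cast hh
  have hlog : 0 ≤ Real.log (((L + 1 : ℕ) : ℝ) * (h : ℝ)) := Real.log_nonneg (by nlinarith)
  have hcost := GCN.code_cost_le (u := s * B / γ) (by linarith) hh' (by nlinarith)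
    (by rw [le_div_iff₀ hγ]; linarith) (by linarith) (Nat.cast_nonneg a) ha (Nat.cast_nonneg r) hr
    (GCN.log_card_atomCode_le hh hd)
  have hdev := GCN.sqrt_code_cost_le (lm := (m : ℝ) * ((L + 1 : ℕ) : ℝ)) (m := m)
    (Q := B ^ 2 * ((L + 1 : ℕ) : ℝ) ^ 2 * (h : ℝ)
      * Real.log (((L + 1 : ℕ) : ℝ) * (h : ℝ)) * GCN.complexity W)
    hδ hδ1 hγ hm0 (by
      have : (1 : ℝ) ≤ m := by exact_mod_cast hm
      nlinarith) hcost
    (by rw [GCN.complexity_eq]; field_simp; rfl) rfl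
  have hE : D.real {z | a * γ / (8 * B) * GCN.margin (GCN.codedWeights a g) z ≤ γ / 2}
      ≤ (1 / (m : ℝ)) * ∑ i, {z | a * γ / (8 * B) *
          GCN.margin (GCN.codedWeights a g) z ≤ γ / 2}.indicator (fun _ => (1 : ℝ)) (S i)
        + √((Real.log (1 / δ) + (a + r + 2) * Real.log 2
          + r * Real.log (Fintype.card (GCN.AtomCode L d h))) / (2 * m)) :=
    not_lt.1 fun hlt => hgood ⟨a, r, g, hlt⟩
  have hexp : GCN.expectedLoss D 0 W
      ≤ D.real {z | a * γ / (8 * B) * GCN.margin (GCN.codedWeights a g) z ≤ γ / 2} := by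
    refine ENNReal.toReal_mono (measure_ne_top _ _) (measure_mono_ae ?_)
    filter_upwards [hadm] with z hz hz0
    have h1 := (abs_le.1 (hg z hz)).2
    have h2 : GCN.margin W z ≤ 0 := hz0
    change a * γ / (8 * B) * GCN.margin (GCN.codedWeights a g) z ≤ γ / 2
    linarith
  have hemp : (1 / (m : ℝ)) * ∑ i, {z | a * γ / (8 * B) *
        GCN.margin (GCN.codedWeights a g) z ≤ γ / 2}.indicator (fun _ => (1 : ℝ)) (S i)
      ≤ GCN.empiricalLoss S γ W := by
    unfold GCN.empiricalLoss
    refine mul_le_mul_of_nonneg_left (Finset.sum_le_sum fun i _ => ?_) (by positivity)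
    by_cases hi : S i ∈ {z | a * γ / (8 * B) * GCN.margin (GCN.codedWeights a g) z ≤ γ / 2}
    · have h1 := (abs_le.1 (hg (S i) (hS i))).1
      have h2 : S i ∈ {z | GCN.margin W z ≤ γ} := by
        have h3 : a * γ / (8 * B) * GCN.margin (GCN.codedWeights a g) (S i) ≤ γ / 2 := hi
        change GCN.margin W (S i) ≤ γ
        linarith
      rw [Set.indicator_of_mem h2]
      exact Set.indicator_le_self' (fun _ _ => zero_le_one) _
    · rw [Set.indicator_of_notMem hi]
      exact Set.indicator_nonneg (fun _ _ => zero_le_one) _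
  rw [add_assoc (Real.log (1 / δ))] at hE
  linarith
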